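/- Conventions. Indices range over $\mathbb N$, and "recursive" means total recursive. A (multiple) sequence of rationals is recursive if it has the form $(-1)^{s}a/b$ with recursive functions $s,a,b$ into $\mathbb N$ and $b$ nowhere $0$. A (multiple) sequence of reals $\{x_i\}$ is computable if there is a recursive sequence of rationals $\{r_{i,k}\}$ with $|x_i-r_{i,k}|\le 2^{-k}$ for all $i,k$. A sequence of functions $f_n:\mathbb R\to\mathbb R$ is computable if (i) the double sequence $\{f_n(x_m)\}$ is computable for every computable sequence of reals $\{x_m\}$, and (ii) there is a recursive function $\alpha(n,L,k)$ such that $|x|,|y|\le L$ and $|x-y|<2^{-\alpha(n,L,k)}$ imply $|f_n(x)-f_n(y)|<2^{-k}$. It is computable with compact support if, moreover, there is a recursive function $L(n)$ with $f_n(x)=0$ whenever $|x|\ge L(n)$. A probability distribution is a Borel probability measure on $\mathbb R$, and $\mu(f)=\int_{\mathbb R}f\,d\mu$. A sequence of probability distributions $\{\mu_m\}$ is computable if $\{\mu_m(f_n)\}$ is a computable double sequence of reals for every computable sequence $\{f_n\}$ with compact support. It converges effectively to a probability distribution $\mu$ if for every computable sequence $\{f_n\}$ with compact support there is a recursive function $\alpha(n,k)$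 such that $|\mu_m(f_n)-\mu(f_n)|<2^{-k}$ whenever $m\ge\alpha(n,k)$. Theorem. Let $\{\mu_m\}$ be a computable sequence of probability distributions that converges effectively to a probability distribution $\mu$, and let $\varphi_m(t)=\int_{\mathbb R}e^{itx}\,\mu_m(dx)$ and $\varphi(t)=\int_{\mathbb R}e^{itx}\,\mu(dx)$ be the characteristic functions. Then $\{\varphi_m\}$ converges effectively to $\varphi$, that is, there is a recursive function $\alpha(L,k)$ such that $$|\varphi_m(t)-\varphi(t)|<2^{-k}\qquad\text{whenever } m\ge\alpha(L,k)\text{ and } |t|\le L .$$ -/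

import Mathlib

open MeasureTheory

/-- A family of rationals indexed by an effectively coded type (such as `ℕ` or `ℕ × ℕ`) is recursive
if it can be written `r i = (-1) ^ s i * (a i / b i)` with recursive `s`, `a`, `b` and `b i ≠ 0`. -/
def IsRecursiveRat {ι : Type} [Primcodable ι] (r : ι → ℚ) : Prop :=
  ∃ s a b : ι → ℕ, Computable s ∧ Computable a ∧ Computable b ∧
    ∀ i, b i ≠ 0 ∧ r i = (-1) ^ s i * ((a i : ℚ) / (b i : ℚ))

/-- A (multiple) sequence of reals is computable if it is approximated, effectively in all indices,
by a recursive sequence of rationals. -/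
def IsComputableReal {ι : Type} [Primcodable ι] (x : ι → ℝ) : Prop :=
  ∃ r : ι × ℕ → ℚ, IsRecursiveRat r ∧ ∀ i k, |x i - (r (i, k) : ℝ)| ≤ (1 / 2 : ℝ) ^ k

/-- Computability of a sequence of functions `ℝ → ℝ`, in the sense of Pour-El and Richards:
sequential computability and effective continuity on bounded intervals. -/
structure IsComputableFunSeq (f : ℕ → ℝ → ℝ) : Prop where
  sequential : ∀ x : ℕ → ℝ, IsComputableReal x →
    IsComputableReal (fun p : ℕ × ℕ => f p.1 (x p.2))
  continuity : ∃ α : ℕ × ℕ × ℕ → ℕ, Computable α ∧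
    ∀ n L k : ℕ, ∀ x y : ℝ, |x| ≤ L → |y| ≤ L →
      |x - y| < (1 / 2 : ℝ) ^ α (n, L, k) → |f n x - f n y| < (1 / 2 : ℝ) ^ k

/-- A computable sequence of functions with compact support: there is a recursive `L` such that
`f n` vanishes at all `x` with `|x| ≥ L n`. -/
def IsComputableCompactSupport (f : ℕ → ℝ → ℝ) : Prop :=
  IsComputableFunSeq f ∧
    ∃ L : ℕ → ℕ, Computable L ∧ ∀ n : ℕ, ∀ x : ℝ, (L n : ℝ) ≤ |x| → f n x = 0

/-- Computability of a sequence of probability distributions on `ℝ`. -/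
def IsComputableDistSeq (μ : ℕ → ProbabilityMeasure ℝ) : Prop :=
  ∀ f : ℕ → ℝ → ℝ, IsComputableCompactSupport f →
    IsComputableReal (fun p : ℕ × ℕ => ∫ x, f p.2 x ∂(μ p.1 : Measure ℝ))

/-- Effective convergence of a sequence of probability distributions on `ℝ`. -/
def DistConvergesEffectively (μ : ℕ → ProbabilityMeasure ℝ) (ν : ProbabilityMeasure ℝ) : Prop :=
  ∀ f : ℕ → ℝ → ℝ, IsComputableCompactSupport f →
    ∃ α : ℕ × ℕ → ℕ, Computable α ∧ ∀ n k m : ℕ, α (n, k) ≤ m →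
      |(∫ x, f n x ∂(μ m : Measure ℝ)) - ∫ x, f n x ∂(ν : Measure ℝ)| < (1 / 2 : ℝ) ^ k

/-- Effective convergence of a sequence of complex-valued functions on `ℝ`: uniform on each
interval `[-L, L]`, with a modulus that is recursive in `L` and the precision. -/
def FunConvergesEffectively (f : ℕ → ℝ → ℂ) (g : ℝ → ℂ) : Prop :=
  ∃ α : ℕ × ℕ → ℕ, Computable α ∧ ∀ L k m : ℕ, α (L, k) ≤ m →
    ∀ t : ℝ, |t| ≤ L → ‖f m t - g t‖ < (1 / 2 : ℝ) ^ k

/-! On `[-L, L]` the character $e^{itx}$ is interpolated by hat functions at the nodes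
$(j-M)/(q+1)$, $0\le j\le 2M$. With $w$ the sum of the hats, a trapezoid, the error is at most
$(1-w(x)) + L/(q+1)$. Here $t$ enters only through unimodular coefficients, so two characteristic
functions differ on `[-L, L]` by at most their two tail terms, twice the mesh error and finitely
many differences of hat integrals, uniformly in $t$ (`norm_charFun_sub_charFun_le`).

It remains to choose the data recursively. The mesh is explicit. The width $M$ is found by search:
integrals against the limit are computable, being effective limits, and the search halts because the
limit has mass $1$ (`exists_computable_trapezoid_width`). Convergence on the wide trapezoid then
transfers the tail bound to $\mu_m$. All test functions lie in the one computable sequence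
`trapezoidSeq`. -/

section Computability

/-! ### Closure properties of recursive functions. -/

variable {α : Type*} [Primcodable α]

theorem Computable.natAdd {f g : α → ℕ} (hf : Computable f) (hg : Computable g) :
    Computable fun a => f a + g a :=
  Primrec.nat_add.to_comp.comp hf hg

theorem Computable.natSub {f g : α → ℕ} (hf : Computable f) (hg : Computable g) :
    Computable fun a => f a - g a :=
  Primrec.nat_sub.to_comp.comp hf hg

theorem Computable.natMul {f g : α → ℕ} (hf : Computable f) (hg : Computable g) :
    Computable fun a => f a * g a :=
  Primrec.nat_mul.to_comp.comp hf hg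

theorem Computable.natMod {f g : α → ℕ} (hf : Computable f) (hg : Computable g) :
    Computable fun a => f a % g a :=
  Primrec.nat_mod.to_comp.comp hf hg

theorem Computable.natMin {f g : α → ℕ} (hf : Computable f) (hg : Computable g) :
    Computable fun a => min (f a) (g a) :=
  Primrec.nat_min.to_comp.comp hf hg

theorem Computable.natPair {f g : α → ℕ} (hf : Computable f) (hg : Computable g) :
    Computable fun a => Nat.pair (f a) (g a) :=
  Primrec₂.natPair.to_comp.comp hf hg

theorem Computable.natPow {f g : α → ℕ} (hf : Computable f) (hg : Computable g) :
    Computable fun a => f a ^ g a :=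
  (Primrec₂.unpaired'.1 Nat.Primrec.pow).to_comp.comp hf hg

/-- A finite sum of a computable function up to a computable bound is computable. -/
theorem Computable.sum_range {f : α × ℕ → ℕ} {g : α → ℕ} (hf : Computable f)
    (hg : Computable g) : Computable fun a => ∑ j ∈ Finset.range (g a), f (a, j) := by
  have hstep : Computable₂ fun (a : α) (p : ℕ × ℕ) => p.2 + f (a, p.1) :=
    Computable.natAdd (Computable.snd.comp Computable.snd)
      (hf.comp (Computable.pair Computable.fst (Computable.fst.comp Computable.snd)))
  refine (Computable.nat_rec hg (Computable.const 0) hstep).of_eq fun a => ?_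
  generalize g a = n
  induction n with
  | zero => simp
  | succ n ih => rw [Finset.sum_range_succ, ← ih]

/-- Unbounded search for a decidable property that always has a witness is computable. -/
theorem Computable.exists_search {p : α → ℕ → Bool} (hp : Computable₂ p)
    (h : ∀ a, ∃ n, p a n = true) : ∃ f : α → ℕ, Computable f ∧ ∀ a, p a (f a) = true := by
  refine ⟨fun a => Nat.find (h a), ?_, fun a => Nat.find_spec (h a)⟩
  refine (Partrec.rfind hp.partrec₂).of_eq fun a => ?_
  refine Part.eq_some_iff.2 (Nat.mem_rfind.2 ⟨?_, fun {m} hm => ?_⟩)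
  · simpa using (Nat.find_spec (h a))
  · simpa using (Nat.find_min (h a) hm)

end Computability

/-! ### Computable reals: effective limits and search. -/

section ComputableReal

variable {ι κ : Type} [Primcodable ι] [Primcodable κ]

theorem IsRecursiveRat.comp {r : ι → ℚ} (hr : IsRecursiveRat r) {g : κ → ι}
    (hg : Computable g) : IsRecursiveRat fun i => r (g i) := by
  obtain ⟨s, a, b, hs, ha, hb, h⟩ := hr
  exact ⟨_, _, _, hs.comp hg, ha.comp hg, hb.comp hg, fun i => h (g i)⟩

theorem IsComputableReal.comp {x : ι → ℝ} (hx : IsComputableReal x) {g : κ → ι}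
    (hg : Computable g) : IsComputableReal fun i => x (g i) := by
  obtain ⟨r, hr, h⟩ := hx
  exact ⟨_, hr.comp (Computable.pair (hg.comp Computable.fst) Computable.snd),
    fun i k => h (g i) k⟩

/-- An effective limit of a computable double sequence is computable. -/
theorem IsComputableReal.of_effective_limit {x : ℕ × ι → ℝ} (hx : IsComputableReal x) {y : ι → ℝ}
    {α : ι × ℕ → ℕ} (hα : Computable α)
    (h : ∀ i k m, α (i, k) ≤ m → |x (m, i) - y i| < (1 / 2 : ℝ) ^ k) : IsComputableReal y := by
  obtain ⟨r, hr, hrx⟩ := hx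
  have hk : Computable fun p : ι × ℕ => p.2 + 1 := Computable.succ.comp Computable.snd
  refine ⟨fun p => r ((α (p.1, p.2 + 1), p.1), p.2 + 1), hr.comp (Computable.pair
    (Computable.pair (hα.comp (Computable.pair Computable.fst hk)) Computable.fst) hk),
    fun i k => ?_⟩
  have h1 := h i (k + 1) _ le_rfl
  have h2 := hrx (α (i, k + 1), i) (k + 1)
  have h3 : (1 / 2 : ℝ) ^ (k + 1) + (1 / 2 : ℝ) ^ (k + 1) = (1 / 2) ^ k := by ring
  rw [abs_lt] at h1
  rw [abs_le] at h2 ⊢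
  constructor <;> linarith [h1.1, h1.2, h2.1, h2.2]

/-- The truth value of a comparison of a recursive rational `(-1) ^ s * (a / b)` with
`1 - 2 * (1 / 2) ^ k`, in terms of natural numbers. -/
theorem one_sub_lt_signed_div_iff {s a b k : ℕ} (hb : b ≠ 0) (hk : 2 ≤ k) :
    b * 2 ^ k < (1 - s % 2) * a * 2 ^ k + 2 * b ↔
      1 - 2 * (1 / 2 : ℝ) ^ k < (-1) ^ s * ((a : ℝ) / b) := by
  have hb' : (0 : ℝ) < b := by positivity
  have h2 : (0 : ℝ) < 2 ^ k := by positivity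
  have h4 : (4 : ℝ) ≤ 2 ^ k := by
    calc (4 : ℝ) = 2 ^ 2 := by norm_num
      _ ≤ 2 ^ k := pow_le_pow_right₀ (by norm_num) hk
  have hrw : 1 - 2 * (1 / 2 : ℝ) ^ k = (2 ^ k - 2) / 2 ^ k := by
    rw [one_div, inv_pow]; field_simp
  rw [hrw]
  rcases Nat.even_or_odd s with hs | hs
  · rw [hs.neg_one_pow, one_mul, div_lt_div_iff₀ h2 hb', Nat.even_iff.1 hs]
    rw [← Nat.cast_lt (α := ℝ)]
    push_cast
    constructor <;> intro h <;> nlinarith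
  -- For odd `s` both sides are false: the factor `1 - s % 2` vanishes, and `2 ≤ k` makes the
  -- threshold nonnegative.
  · rw [hs.neg_one_pow, Nat.odd_iff.1 hs]
    constructor
    · intro h
      exfalso
      have h5 : b * 2 ^ 2 ≤ b * 2 ^ k :=
        Nat.mul_le_mul_left b (Nat.pow_le_pow_right (by norm_num) hk)
      rw [Nat.sub_self, zero_mul, zero_mul, zero_add] at h
      omega
    · intro h
      exfalso
      have h5 : 0 ≤ (a : ℝ) / b := by positivity
      have h6 : 0 ≤ ((2 : ℝ) ^ k - 2) / 2 ^ k := div_nonneg (by linarith) h2.le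
      linarith

/-- If the computable sequences `n ↦ x (i, n)` come arbitrarily close to `1` from below or exceed
it, an index at which they are close to `1` can be found effectively. -/
theorem IsComputableReal.exists_computable_index {x : ι × ℕ → ℝ} (hx : IsComputableReal x)
    (h : ∀ i k, ∃ n, 1 - (1 / 2 : ℝ) ^ k < x (i, n)) :
    ∃ N : ι × ℕ → ℕ, Computable N ∧ ∀ i k, 1 - (1 / 2 : ℝ) ^ k < x (i, N (i, k)) := by
  obtain ⟨r, ⟨s, a, b, hs, ha, hb, hr⟩, hrx⟩ := hx
  let g : (ι × ℕ) × ℕ → (ι × ℕ) × ℕ := fun p => ((p.1.1, p.2), p.1.2 + 2)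
  have hk : Computable fun p : (ι × ℕ) × ℕ => p.1.2 + 2 :=
    (Computable.snd.comp Computable.fst).natAdd (Computable.const 2)
  have hg : Computable g :=
    Computable.pair (Computable.pair (Computable.fst.comp Computable.fst) Computable.snd) hk
  have hpow : Computable fun p : (ι × ℕ) × ℕ => 2 ^ (p.1.2 + 2) :=
    (Computable.const 2).natPow hk
  -- With $\delta = 2^{-(k+2)}$ the test is $r > 1-2\delta$. It succeeds whenever $x > 1-\delta$,
  -- and success forces $x > 1-3\delta > 1-2^{-k}$.
  have hp : Computable₂ fun (i : ι × ℕ) (n : ℕ) =>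
      decide (b (g (i, n)) * 2 ^ (i.2 + 2) <
        (1 - s (g (i, n)) % 2) * a (g (i, n)) * 2 ^ (i.2 + 2) + 2 * b (g (i, n))) :=
    Primrec.nat_lt.decide.to_comp.comp ((hb.comp hg).natMul hpow)
      (((((Computable.const 1).natSub ((hs.comp hg).natMod (Computable.const 2))).natMul
        (ha.comp hg)).natMul hpow).natAdd ((Computable.const 2).natMul (hb.comp hg)))
  have hcond : ∀ (i : ι) (k n : ℕ), (b (g ((i, k), n)) * 2 ^ (k + 2) <
      (1 - s (g ((i, k), n)) % 2) * a (g ((i, k), n)) * 2 ^ (k + 2) + 2 * b (g ((i, k), n))) ↔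
      1 - 2 * (1 / 2 : ℝ) ^ (k + 2) < (r ((i, n), k + 2) : ℝ) := by
    intro i k n
    rw [one_sub_lt_signed_div_iff (hr _).1 (by omega), (hr ((i, n), k + 2)).2]
    push_cast
    rfl
  obtain ⟨N, hN, hNp⟩ := Computable.exists_search hp (by
    rintro ⟨i, k⟩
    obtain ⟨n, hn⟩ := h i (k + 2)
    refine ⟨n, decide_eq_true ((hcond i k n).2 ?_)⟩
    have := (abs_le.1 (hrx (i, n) (k + 2))).2
    linarith)
  refine ⟨N, hN, fun i k => ?_⟩
  have h1 := (hcond i k _).1 (of_decide_eq_true (hNp (i, k)))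
  have h2 := (abs_le.1 (hrx (i, N (i, k)) (k + 2))).1
  have h3 : (1 / 2 : ℝ) ^ (k + 2) = (1 / 2) ^ k / 4 := by ring
  have h4 : (0 : ℝ) < (1 / 2) ^ k := by positivity
  linarith

end ComputableReal

/-! ### Trapezoids and a computable enumeration of them. -/

section Trapezoid

/-- The trapezoid function: `1` on `[-h, h]`, `0` outside `[-(h + 1), h + 1]`, and affine in
between. -/
noncomputable def trapezoid (h y : ℝ) : ℝ := max 0 (min 1 (h + 1 - |y|))

theorem trapezoid_nonneg (h y : ℝ) : 0 ≤ trapezoid h y := le_max_left _ _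

theorem trapezoid_le_one (h y : ℝ) : trapezoid h y ≤ 1 :=
  max_le zero_le_one (min_le_left _ _)

theorem trapezoid_eq_zero {h y : ℝ} (hy : h + 1 ≤ |y|) : trapezoid h y = 0 :=
  max_eq_left ((min_le_right _ _).trans (by linarith))

theorem trapezoid_eq_one {h y : ℝ} (hy : |y| ≤ h) : trapezoid h y = 1 := by
  rw [trapezoid, min_eq_left (by linarith), max_eq_right zero_le_one]

theorem abs_trapezoid_sub_le (h y z : ℝ) : |trapezoid h y - trapezoid h z| ≤ |y - z| := by
  have h1 : |max 0 (min 1 (h + 1 - |y|)) - max 0 (min 1 (h + 1 - |z|))| ≤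
      |min 1 (h + 1 - |y|) - min 1 (h + 1 - |z|)| := by
    simpa using abs_max_sub_max_le_max 0 (min 1 (h + 1 - |y|)) 0 (min 1 (h + 1 - |z|))
  have h2 : |min 1 (h + 1 - |y|) - min 1 (h + 1 - |z|)| ≤ |(h + 1 - |y|) - (h + 1 - |z|)| := by
    simpa using abs_min_sub_min_le_max 1 (h + 1 - |y|) 1 (h + 1 - |z|)
  refine (h1.trans h2).trans ?_
  have h3 : (h + 1 - |y|) - (h + 1 - |z|) = |z| - |y| := by ring
  rw [h3, abs_sub_comm y z]
  exact abs_abs_sub_abs_le z y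

theorem continuous_trapezoid (h : ℝ) : Continuous (trapezoid h) := by
  unfold trapezoid; fun_prop

/-- Translates of the hat function `trapezoid 0` by integers add up to a trapezoid. -/
theorem sum_trapezoid_zero (M : ℕ) (y : ℝ) :
    ∑ j ∈ Finset.range (2 * M + 1), trapezoid 0 (y - j + M) = trapezoid M y := by
  -- A hat is the difference of two unit translates of a ramp, so the sum telescopes.
  let ramp : ℝ → ℝ := fun u => max 0 (min 1 u)
  have hhat : ∀ u, trapezoid 0 u = ramp (u + 1) - ramp u := by
    intro u
    simp only [trapezoid, ramp]
    rcases abs_cases u with ⟨h, h'⟩ | ⟨h, h'⟩ <;> rw [h] <;> grind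
  have hsum : ∀ n : ℕ, ∑ j ∈ Finset.range n, trapezoid 0 (y - j + M) =
      ramp (y + M + 1) - ramp (y + M + 1 - n) := by
    intro n
    induction n with
    | zero => simp
    | succ n ih =>
      rw [Finset.sum_range_succ, ih, hhat]
      push_cast
      ring_nf
  rw [hsum]
  have hM : (0 : ℝ) ≤ M := Nat.cast_nonneg M
  have h2 : y + M + 1 - ((2 * M + 1 : ℕ) : ℝ) = y - M := by push_cast; ring
  rw [h2]
  simp only [trapezoid, ramp]
  rcases abs_cases y with ⟨h, h'⟩ | ⟨h, h'⟩ <;> rw [h] <;> grind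

/-- The value of a trapezoid at a fraction, computed with natural numbers. -/
theorem trapezoid_div {B : ℕ} (hB : B ≠ 0) (c P Q : ℕ) :
    trapezoid c (((P : ℝ) - Q) / B) =
      ((min B ((c + 1) * B - ((P - Q) + (Q - P))) : ℕ) : ℝ) / B := by
  have hB' : (0 : ℝ) < B := by positivity
  have habs : |(P : ℝ) - Q| = (((P - Q) + (Q - P) : ℕ) : ℝ) := by
    rcases le_total P Q with h | h
    · rw [abs_of_nonpos (sub_nonpos.2 (Nat.cast_le.2 h)), Nat.sub_eq_zero_of_le h, zero_add,
        Nat.cast_sub h]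
      ring
    · rw [abs_of_nonneg (sub_nonneg.2 (Nat.cast_le.2 h)), Nat.sub_eq_zero_of_le h, add_zero,
        Nat.cast_sub h]
  rw [trapezoid, abs_div, habs, abs_of_pos hB']
  generalize (P - Q) + (Q - P) = D
  have h1 : (c : ℝ) + 1 - (D : ℝ) / B = (((c + 1) * B : ℕ) - (D : ℝ)) / B := by
    push_cast; field_simp
  rw [h1]
  generalize (c + 1) * B = C
  rw [eq_div_iff hB'.ne', max_mul_of_nonneg _ _ hB'.le, min_mul_of_nonneg _ _ hB'.le,
    div_mul_cancel₀ _ hB'.ne', zero_mul, one_mul, Nat.cast_min]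
  rcases le_total D C with h | h
  · rw [Nat.cast_sub h]
    exact max_eq_right (le_min hB'.le (sub_nonneg.2 (Nat.cast_le.2 h)))
  · rw [Nat.sub_eq_zero_of_le h, Nat.cast_zero, min_eq_right hB'.le]
    exact max_eq_left ((min_le_right _ _).trans (sub_nonpos.2 (Nat.cast_le.2 h)))

/-- An index for the trapezoid of half-width `c / (q + 1)` centred at `(a - b) / (q + 1)`. -/
def trapezoidIndex (q a b c : ℕ) : ℕ := Nat.pair q (Nat.pair a (Nat.pair b c))

/-- An enumeration of the trapezoids with rational data. -/
noncomputable def trapezoidSeq (n : ℕ) (x : ℝ) : ℝ :=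
  trapezoid (n.unpair.2.unpair.2.unpair.2 : ℕ)
    (((n.unpair.1 : ℕ) + 1 : ℝ) * x - (n.unpair.2.unpair.1 : ℕ) +
      (n.unpair.2.unpair.2.unpair.1 : ℕ))

theorem trapezoidSeq_index (q a b c : ℕ) (x : ℝ) :
    trapezoidSeq (trapezoidIndex q a b c) x = trapezoid c ((q + 1) * x - a + b) := by
  simp [trapezoidSeq, trapezoidIndex]

/-- Since $q+1\le 2^q$, a factor $q+1$ costs at most $q$ extra bits. It serves both for Lipschitz
constants and for the number of hats. -/
theorem add_one_mul_half_pow_add_le (q k : ℕ) :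
    ((q : ℝ) + 1) * (1 / 2) ^ (k + q) ≤ (1 / 2) ^ k := by
  have h1 : ((q : ℝ) + 1) ≤ 2 ^ q := by exact_mod_cast Nat.lt_two_pow_self (n := q)
  have h2 : (2 : ℝ) ^ q * (1 / 2) ^ q = 1 := by rw [← mul_pow]; norm_num
  have h3 : (0 : ℝ) < (1 / 2) ^ q := by positivity
  have h4 : (0 : ℝ) < (1 / 2) ^ k := by positivity
  rw [pow_add]
  nlinarith [mul_le_mul_of_nonneg_right h1 (mul_pos h4 h3).le]

theorem abs_trapezoid_affine_sub_le (q : ℕ) (a b c x y : ℝ) :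
    |trapezoid c ((q + 1) * x - a + b) - trapezoid c ((q + 1) * y - a + b)| ≤
      (q + 1) * |x - y| := by
  refine (abs_trapezoid_sub_le _ _ _).trans_eq ?_
  have h : (q + 1) * x - a + b - ((q + 1) * y - a + b) = (q + 1) * (x - y) := by ring
  rw [h, abs_mul, abs_of_nonneg (by positivity : (0 : ℝ) ≤ q + 1)]

theorem computable_unpair_fst : Computable fun n : ℕ => n.unpair.1 :=
  Computable.fst.comp Computable.unpair

theorem computable_unpair_snd : Computable fun n : ℕ => n.unpair.2 :=
  Computable.snd.comp Computable.unpair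

theorem isComputableReal_trapezoidSeq {x : ℕ → ℝ} (hx : IsComputableReal x) :
    IsComputableReal fun p : ℕ × ℕ => trapezoidSeq p.1 (x p.2) := by
  obtain ⟨r, ⟨s, A, B, hs, hA, hB, hr⟩, hrx⟩ := hx
  let q : (ℕ × ℕ) × ℕ → ℕ := fun p => p.1.1.unpair.1
  let a : (ℕ × ℕ) × ℕ → ℕ := fun p => p.1.1.unpair.2.unpair.1
  let b : (ℕ × ℕ) × ℕ → ℕ := fun p => p.1.1.unpair.2.unpair.2.unpair.1
  let c : (ℕ × ℕ) × ℕ → ℕ := fun p => p.1.1.unpair.2.unpair.2.unpair.2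
  have hn : Computable fun p : (ℕ × ℕ) × ℕ => p.1.1 := Computable.fst.comp Computable.fst
  have hn2 := computable_unpair_snd.comp hn
  have hn3 := computable_unpair_snd.comp hn2
  have hq : Computable q := computable_unpair_fst.comp hn
  have ha : Computable a := computable_unpair_fst.comp hn2
  have hb : Computable b := computable_unpair_fst.comp hn3
  have hc : Computable c := computable_unpair_snd.comp hn3
  let g : (ℕ × ℕ) × ℕ → ℕ × ℕ := fun p => (p.1.2, p.2 + q p)
  have hg : Computable g :=
    Computable.pair (Computable.snd.comp Computable.fst) (Computable.snd.natAdd hq)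
  have hq1 : Computable fun p => q p + 1 := Computable.succ.comp hq
  have hpar : Computable fun p => s (g p) % 2 := (hs.comp hg).natMod (Computable.const 2)
  -- `P - Q` is the numerator of $(q+1)r - a + b$ over the denominator `B`. The sign of $r$ decides
  -- which of the two receives its term, so everything stays in `ℕ`.
  let P : (ℕ × ℕ) × ℕ → ℕ := fun p =>
    b p * B (g p) + (1 - s (g p) % 2) * ((q p + 1) * A (g p))
  let Q : (ℕ × ℕ) × ℕ → ℕ := fun p => a p * B (g p) + s (g p) % 2 * ((q p + 1) * A (g p))
  have hP : Computable P := (hb.natMul (hB.comp hg)).natAdd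
    (((Computable.const 1).natSub hpar).natMul (hq1.natMul (hA.comp hg)))
  have hQ : Computable Q := (ha.natMul (hB.comp hg)).natAdd
    (hpar.natMul (hq1.natMul (hA.comp hg)))
  let N : (ℕ × ℕ) × ℕ → ℕ := fun p =>
    min (B (g p)) ((c p + 1) * B (g p) - ((P p - Q p) + (Q p - P p)))
  have hN : Computable N := (hB.comp hg).natMin
    (((Computable.succ.comp hc).natMul (hB.comp hg)).natSub
      ((hP.natSub hQ).natAdd (hQ.natSub hP)))
  refine ⟨fun p => (N p : ℚ) / B (g p), ⟨fun _ => 0, N, fun p => B (g p), Computable.const 0, hN,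
    hB.comp hg, fun p => ⟨(hr _).1, by simp⟩⟩, fun i k => ?_⟩
  set p : (ℕ × ℕ) × ℕ := (i, k)
  have hB0 : B (g p) ≠ 0 := (hr (g p)).1
  have hB0' : (B (g p) : ℝ) ≠ 0 := Nat.cast_ne_zero.2 hB0
  have hval : (((N p : ℚ) / B (g p) : ℚ) : ℝ) =
      trapezoid (c p) ((q p + 1) * (r (g p) : ℝ) - a p + b p) := by
    have h1 : ((q p : ℝ) + 1) * (r (g p) : ℝ) - a p + b p = ((P p : ℝ) - Q p) / B (g p) := by
      rw [(hr (g p)).2]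
      simp only [P, Q]
      rcases Nat.even_or_odd (s (g p)) with he | ho
      · rw [he.neg_one_pow, Nat.even_iff.1 he]
        push_cast
        field_simp
        ring
      · rw [ho.neg_one_pow, Nat.odd_iff.1 ho]
        push_cast
        field_simp
        ring
    rw [h1, trapezoid_div hB0, Rat.cast_div, Rat.cast_natCast, Rat.cast_natCast]
  rw [hval]
  refine (abs_trapezoid_affine_sub_le (q p) (a p) (b p) (c p) (x i.2) (r (g p))).trans ?_
  refine (mul_le_mul_of_nonneg_left (hrx i.2 (k + q p)) (by positivity)).trans ?_
  exact add_one_mul_half_pow_add_le (q p) k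

theorem isComputableCompactSupport_trapezoidSeq : IsComputableCompactSupport trapezoidSeq := by
  refine ⟨⟨fun x hx => isComputableReal_trapezoidSeq hx, ?_⟩, ?_⟩
  · refine ⟨fun p => p.2.2 + p.1.unpair.1, (Computable.snd.comp Computable.snd).natAdd
      (computable_unpair_fst.comp Computable.fst), fun n L k x y _ _ hxy => ?_⟩
    refine (abs_trapezoid_affine_sub_le _ _ _ _ x y).trans_lt ?_
    exact (mul_lt_mul_of_pos_left hxy (by positivity)).trans_le (add_one_mul_half_pow_add_le _ k)
  · have hn3 := computable_unpair_snd.comp computable_unpair_snd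
    -- The slope is at least $1$, so $|x|\ge c+1+a+b$ gives $|(q+1)x-a+b|\ge c+1$.
    refine ⟨fun n => n.unpair.2.unpair.2.unpair.2 + 1 + n.unpair.2.unpair.1 +
      n.unpair.2.unpair.2.unpair.1,
      (((Computable.succ.comp (computable_unpair_snd.comp hn3)).natAdd
        (computable_unpair_fst.comp computable_unpair_snd)).natAdd
        (computable_unpair_fst.comp hn3)), fun n x hx => ?_⟩
    refine trapezoid_eq_zero ?_
    push_cast at hx
    have hq : (0 : ℝ) ≤ (n.unpair.1 : ℕ) := Nat.cast_nonneg _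
    have ha : (0 : ℝ) ≤ (n.unpair.2.unpair.1 : ℕ) := Nat.cast_nonneg _
    have hb : (0 : ℝ) ≤ (n.unpair.2.unpair.2.unpair.1 : ℕ) := Nat.cast_nonneg _
    generalize ((n.unpair.1 : ℕ) : ℝ) = q at *
    generalize ((n.unpair.2.unpair.1 : ℕ) : ℝ) = a at *
    generalize ((n.unpair.2.unpair.2.unpair.1 : ℕ) : ℝ) = b at *
    rcases abs_cases x with ⟨h, h'⟩ | ⟨h, h'⟩
    · rw [h] at hx
      refine le_trans ?_ (le_abs_self _)
      nlinarith [mul_nonneg hq h']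
    · rw [h] at hx
      refine le_trans ?_ (neg_le_abs _)
      nlinarith [mul_nonneg hq (neg_nonneg.2 h'.le)]

end Trapezoid

/-! ### Characteristic functions through hat integrals. -/

section CharFun

theorem integrable_trapezoid_affine (ρ : Measure ℝ) [IsFiniteMeasure ρ] (h q d : ℝ) :
    Integrable (fun x => trapezoid h (q * x + d)) ρ := by
  refine Integrable.of_bound (C := 1)
    ((continuous_trapezoid h).comp (by fun_prop)).aestronglyMeasurable
    (Filter.Eventually.of_forall fun x => ?_)
  rw [Real.norm_of_nonneg (trapezoid_nonneg _ _)]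
  exact trapezoid_le_one _ _

/-- Trapezoids of increasing width have integrals converging to `1`. -/
theorem exists_lt_integral_trapezoid (ρ : Measure ℝ) [IsProbabilityMeasure ρ] (q : ℝ) {ε : ℝ}
    (hε : 0 < ε) : ∃ M : ℕ, 1 - ε < ∫ x, trapezoid M (q * x) ∂ρ := by
  have hlim : Filter.Tendsto (fun M : ℕ => ∫ x, trapezoid M (q * x) ∂ρ) Filter.atTop
      (nhds (∫ _, (1 : ℝ) ∂ρ)) := by
    refine tendsto_integral_of_dominated_convergence (fun _ => (1 : ℝ)) (fun M => ?_)
      (integrable_const 1) (fun M => Filter.Eventually.of_forall fun x => ?_)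
      (Filter.Eventually.of_forall fun x => ?_)
    · simpa using (integrable_trapezoid_affine ρ M q 0).aestronglyMeasurable
    · rw [Real.norm_of_nonneg (trapezoid_nonneg _ _)]
      exact trapezoid_le_one _ _
    · refine tendsto_const_nhds.congr' ?_
      filter_upwards [tendsto_natCast_atTop_atTop.eventually_ge_atTop |q * x|] with M hM
      exact (trapezoid_eq_one hM).symm
  have h1 : ∫ _, (1 : ℝ) ∂ρ = 1 := by simp
  rw [h1] at hlim
  exact (hlim.eventually_const_lt (by linarith : 1 - ε < 1)).exists

theorem norm_exp_ofReal_mul_I_sub_le (u v : ℝ) :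
    ‖Complex.exp (u * Complex.I) - Complex.exp (v * Complex.I)‖ ≤ |u - v| := by
  have h : Complex.exp (u * Complex.I) - Complex.exp (v * Complex.I) =
      Complex.exp (v * Complex.I) * (Complex.exp (Complex.I * ((u - v : ℝ) : ℂ)) - 1) := by
    rw [mul_sub, ← Complex.exp_add]
    push_cast
    ring_nf
  rw [h, norm_mul, Complex.norm_exp_ofReal_mul_I, one_mul]
  exact Real.norm_exp_I_mul_ofReal_sub_one_le

/-- The character `x ↦ exp (i t x)` is approximated by its interpolation with hat functions. -/
theorem norm_exp_sub_sum_trapezoid_le (q M : ℕ) {t L : ℝ} (ht : |t| ≤ L) (x : ℝ) :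
    ‖Complex.exp (t * x * Complex.I) - ∑ j ∈ Finset.range (2 * M + 1),
      Complex.exp ((t * ((j - M) / (q + 1)) : ℝ) * Complex.I) *
        (trapezoid 0 ((q + 1) * x - j + M) : ℂ)‖ ≤
      (1 - trapezoid M ((q + 1) * x)) + L / (q + 1) := by
  set h : ℕ → ℝ := fun j => trapezoid 0 ((q + 1) * x - j + M)
  set e : ℕ → ℂ := fun j => Complex.exp ((t * ((j - M) / (q + 1)) : ℝ) * Complex.I)
  set w := trapezoid M ((q + 1) * x)
  set E : ℂ := Complex.exp (t * x * Complex.I)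
  have hq : (0 : ℝ) < q + 1 := by positivity
  have hL : 0 ≤ L := (abs_nonneg t).trans ht
  have hsum : ∑ j ∈ Finset.range (2 * M + 1), h j = w := sum_trapezoid_zero M ((q + 1) * x)
  have hE : E = Complex.exp ((t * x : ℝ) * Complex.I) := by simp [E]
  have hEn : ‖E‖ = 1 := by rw [hE, Complex.norm_exp_ofReal_mul_I]
  have hterm : ∀ j, ‖(E - e j) * (h j : ℂ)‖ ≤ L / (q + 1) * h j := by
    intro j
    have hj0 : 0 ≤ h j := trapezoid_nonneg _ _
    rw [norm_mul, Complex.norm_real, Real.norm_of_nonneg hj0]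
    -- The hat `h j` lives within $1/(q+1)$ of its node, where the character varies by at most
    -- $L/(q+1)$.
    by_cases hx : 0 + 1 ≤ |(q + 1) * x - j + M|
    · simp only [h, trapezoid_eq_zero hx, mul_zero, le_refl]
    · refine mul_le_mul_of_nonneg_right ?_ hj0
      rw [hE]
      refine (norm_exp_ofReal_mul_I_sub_le _ _).trans ?_
      have h1 : t * x - t * ((j - M) / (q + 1)) = t * ((q + 1) * x - j + M) / (q + 1) := by
        field_simp
        ring
      rw [h1, abs_div, abs_mul, abs_of_pos hq]
      refine div_le_div_of_nonneg_right ?_ hq.le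
      push Not at hx
      calc |t| * |(q + 1) * x - j + M| ≤ L * 1 :=
            mul_le_mul ht (by linarith) (abs_nonneg _) hL
        _ = L := mul_one L
  -- The hats sum to `w`, so the mass $1-w$ that they miss is split off.
  have hsplit : E - ∑ j ∈ Finset.range (2 * M + 1), e j * (h j : ℂ) =
      E * ((1 - w : ℝ) : ℂ) + ∑ j ∈ Finset.range (2 * M + 1), (E - e j) * (h j : ℂ) := by
    simp only [sub_mul, Finset.sum_sub_distrib, ← Finset.mul_sum]
    rw [← hsum]
    push_cast
    ring
  have hw1 : w ≤ 1 := trapezoid_le_one _ _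
  rw [hsplit]
  refine (norm_add_le _ _).trans (add_le_add ?_ ?_)
  · rw [norm_mul, hEn, one_mul, Complex.norm_real, Real.norm_of_nonneg (sub_nonneg.2 hw1)]
  · refine (norm_sum_le_of_le _ fun j _ => hterm j).trans ?_
    rw [← Finset.mul_sum, hsum]
    exact mul_le_of_le_one_right (by positivity) hw1

/-- The characteristic function is approximated, uniformly on `[-L, L]`, by a combination of
integrals of hat functions. -/
theorem norm_charFun_sub_sum_trapezoid_le (ρ : Measure ℝ) [IsProbabilityMeasure ρ] (q M : ℕ)
    {t L : ℝ} (ht : |t| ≤ L) :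
    ‖charFun ρ t - ∑ j ∈ Finset.range (2 * M + 1),
      Complex.exp ((t * ((j - M) / (q + 1)) : ℝ) * Complex.I) *
        ((∫ x, trapezoid 0 ((q + 1) * x - j + M) ∂ρ : ℝ) : ℂ)‖ ≤
      (1 - ∫ x, trapezoid M ((q + 1) * x) ∂ρ) + L / (q + 1) := by
  have hint : ∀ j : ℕ, Integrable (fun x => trapezoid 0 ((q + 1) * x - j + M)) ρ := by
    intro j
    refine (integrable_trapezoid_affine ρ 0 (q + 1) (M - j)).congr
      (Filter.Eventually.of_forall fun x => ?_)
    ring_nf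
  have hw : Integrable (fun x => trapezoid M ((q + 1) * x)) ρ := by
    simpa using integrable_trapezoid_affine ρ M (q + 1) 0
  have hE : Integrable (fun x : ℝ => Complex.exp (t * x * Complex.I)) ρ := by
    refine Integrable.of_bound (C := 1) (by fun_prop) (Filter.Eventually.of_forall fun x => ?_)
    rw [← Complex.ofReal_mul, Complex.norm_exp_ofReal_mul_I]
  have hterm : ∀ j ∈ Finset.range (2 * M + 1), Integrable (fun x =>
      Complex.exp ((t * ((j - M) / (q + 1)) : ℝ) * Complex.I) *
        (trapezoid 0 ((q + 1) * x - j + M) : ℂ)) ρ :=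
    fun j _ => (hint j).ofReal.const_mul _
  have heq : charFun ρ t - ∑ j ∈ Finset.range (2 * M + 1),
      Complex.exp ((t * ((j - M) / (q + 1)) : ℝ) * Complex.I) *
        ((∫ x, trapezoid 0 ((q + 1) * x - j + M) ∂ρ : ℝ) : ℂ) =
      ∫ x, (Complex.exp (t * x * Complex.I) - ∑ j ∈ Finset.range (2 * M + 1),
        Complex.exp ((t * ((j - M) / (q + 1)) : ℝ) * Complex.I) *
          (trapezoid 0 ((q + 1) * x - j + M) : ℂ)) ∂ρ := by
    rw [integral_sub hE (integrable_finsetSum _ hterm), integral_finsetSum _ hterm,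
      charFun_apply_real]
    simp only [integral_const_mul, integral_complex_ofReal]
  have hbd : ∫ x, ((1 - trapezoid M ((q + 1) * x)) + L / (q + 1)) ∂ρ =
      (1 - ∫ x, trapezoid M ((q + 1) * x) ∂ρ) + L / (q + 1) := by
    have h1 := integral_add (f := fun x => 1 - trapezoid M ((q + 1) * x))
      ((integrable_const 1).sub hw) (integrable_const (μ := ρ) (L / (q + 1)))
    rw [h1, integral_sub (integrable_const 1) hw]
    simp
  rw [heq, ← hbd]
  exact norm_integral_le_of_norm_le (((integrable_const 1).sub hw).add (integrable_const _))
    (Filter.Eventually.of_forall fun x => norm_exp_sub_sum_trapezoid_le q M ht x)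

/-- Comparison of two characteristic functions through finitely many trapezoid integrals. -/
theorem norm_charFun_sub_charFun_le (ρ σ : Measure ℝ) [IsProbabilityMeasure ρ]
    [IsProbabilityMeasure σ] (q M : ℕ) {t L : ℝ} (ht : |t| ≤ L) :
    ‖charFun ρ t - charFun σ t‖ ≤
      (1 - ∫ x, trapezoid M ((q + 1) * x) ∂ρ) + (1 - ∫ x, trapezoid M ((q + 1) * x) ∂σ) +
        2 * (L / (q + 1)) + ∑ j ∈ Finset.range (2 * M + 1),
          |(∫ x, trapezoid 0 ((q + 1) * x - j + M) ∂ρ) -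
            ∫ x, trapezoid 0 ((q + 1) * x - j + M) ∂σ| := by
  have h1 := norm_charFun_sub_sum_trapezoid_le ρ q M ht
  have h2 := norm_charFun_sub_sum_trapezoid_le σ q M ht
  set e : ℕ → ℂ := fun j => Complex.exp ((t * ((j - M) / (q + 1)) : ℝ) * Complex.I)
  set a : ℕ → ℝ := fun j => ∫ x, trapezoid 0 ((q + 1) * x - j + M) ∂ρ
  set b : ℕ → ℝ := fun j => ∫ x, trapezoid 0 ((q + 1) * x - j + M) ∂σ
  have h3 : ‖∑ j ∈ Finset.range (2 * M + 1), e j * (a j : ℂ) -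
      ∑ j ∈ Finset.range (2 * M + 1), e j * (b j : ℂ)‖ ≤
      ∑ j ∈ Finset.range (2 * M + 1), |a j - b j| := by
    rw [← Finset.sum_sub_distrib]
    refine norm_sum_le_of_le _ fun j _ => ?_
    rw [← mul_sub, ← Complex.ofReal_sub, norm_mul, Complex.norm_exp_ofReal_mul_I, one_mul,
      Complex.norm_real, Real.norm_eq_abs]
  rw [norm_sub_rev] at h2
  have h4 := norm_sub_le_norm_sub_add_norm_sub (charFun ρ t)
    (∑ j ∈ Finset.range (2 * M + 1), e j * (a j : ℂ)) (charFun σ t)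
  have h5 := norm_sub_le_norm_sub_add_norm_sub (∑ j ∈ Finset.range (2 * M + 1), e j * (a j : ℂ))
    (∑ j ∈ Finset.range (2 * M + 1), e j * (b j : ℂ)) (charFun σ t)
  linarith

end CharFun

/-! ### Effective tightness and the recursive modulus. -/

/-- Effective tightness of an effective limit: the trapezoids carrying almost all the mass of the
limit can be found effectively. -/
theorem exists_computable_trapezoid_width {μ : ℕ → ProbabilityMeasure ℝ} {ν : ProbabilityMeasure ℝ}
    (hμ : IsComputableDistSeq μ) {α : ℕ × ℕ → ℕ} (hα : Computable α)
    (h : ∀ n k m : ℕ, α (n, k) ≤ m → |(∫ x, trapezoidSeq n x ∂(μ m : Measure ℝ)) -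
      ∫ x, trapezoidSeq n x ∂(ν : Measure ℝ)| < (1 / 2 : ℝ) ^ k) :
    ∃ W : ℕ × ℕ → ℕ, Computable W ∧ ∀ q k : ℕ, 1 - (1 / 2 : ℝ) ^ k <
      ∫ x, trapezoid (W (q, k)) ((q + 1) * x) ∂(ν : Measure ℝ) := by
  have hν : IsComputableReal fun n => ∫ x, trapezoidSeq n x ∂(ν : Measure ℝ) :=
    (hμ _ isComputableCompactSupport_trapezoidSeq).of_effective_limit hα h
  have hidx : Computable fun p : ℕ × ℕ => trapezoidIndex p.1 0 0 p.2 :=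
    Computable.fst.natPair ((Computable.const 0).natPair ((Computable.const 0).natPair
      Computable.snd))
  have heq : ∀ q M : ℕ, ∫ x, trapezoidSeq (trapezoidIndex q 0 0 M) x ∂(ν : Measure ℝ) =
      ∫ x, trapezoid M ((q + 1) * x) ∂(ν : Measure ℝ) := by
    intro q M
    simp [trapezoidSeq_index]
  obtain ⟨W, hW, hWν⟩ := (hν.comp hidx).exists_computable_index fun q k => by
    simpa only [heq] using exists_lt_integral_trapezoid (ν : Measure ℝ) ((q : ℝ) + 1)
      (by positivity : (0 : ℝ) < (1 / 2) ^ k)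
  exact ⟨W, hW, fun q k => by simpa only [heq] using hWν q k⟩

theorem theorem4p3 (μ : ℕ → ProbabilityMeasure ℝ) (ν : ProbabilityMeasure ℝ)
    (hμ : IsComputableDistSeq μ) (hconv : DistConvergesEffectively μ ν) :
    FunConvergesEffectively (fun m t => charFun (μ m : Measure ℝ) t)
      (fun t => charFun (ν : Measure ℝ) t) := by
  obtain ⟨α, hα, hαμ⟩ := hconv _ isComputableCompactSupport_trapezoidSeq
  obtain ⟨W, hW, hWν⟩ := exists_computable_trapezoid_width hμ hα hαμ
  -- Chosen so that the mesh error $L/(q+1)$ is at most $2^{-(k+3)}$.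
  let q : ℕ × ℕ → ℕ := fun p => p.1 * 2 ^ (p.2 + 3)
  let M : ℕ × ℕ → ℕ := fun p => W (q p, p.2 + 3)
  have hk : Computable fun p : ℕ × ℕ => p.2 + 3 := Computable.snd.natAdd (Computable.const 3)
  have hq : Computable q := Computable.fst.natMul ((Computable.const 2).natPow hk)
  have hM : Computable M := hW.comp (Computable.pair hq hk)
  have hlen : Computable fun p => 2 * M p + 1 :=
    Computable.succ.comp ((Computable.const 2).natMul hM)
  let A : ℕ × ℕ → ℕ := fun p => α (trapezoidIndex (q p) 0 0 (M p), p.2 + 3)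
  have hA : Computable A := hα.comp (Computable.pair (hq.natPair ((Computable.const 0).natPair
    ((Computable.const 0).natPair hM))) hk)
  -- The extra $n = 2M+1$ bits pay for summing $n$ errors, since $n2^{-n}\le 1$.
  let C : (ℕ × ℕ) × ℕ → ℕ := fun p =>
    α (trapezoidIndex (q p.1) p.2 (M p.1) 0, p.1.2 + 3 + (2 * M p.1 + 1))
  have hC : Computable C := hα.comp (Computable.pair ((hq.comp Computable.fst).natPair
    (Computable.snd.natPair ((hM.comp Computable.fst).natPair (Computable.const 0))))
    ((hk.comp Computable.fst).natAdd (hlen.comp Computable.fst)))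
  -- A sum of moduli dominates each of them and thus replaces a maximum.
  refine ⟨fun p => A p + ∑ j ∈ Finset.range (2 * M p + 1), C (p, j),
    hA.natAdd (hC.sum_range hlen), fun L k m hm t ht => ?_⟩
  set n := 2 * M (L, k) + 1
  set ε : ℝ := (1 / 2) ^ (k + 3) with hε
  have hε0 : 0 < ε := by positivity
  have hwidth := hWν (q (L, k)) (k + 3)
  have htrap := hαμ (trapezoidIndex (q (L, k)) 0 0 (M (L, k))) (k + 3) m
    ((Nat.le_add_right _ _).trans hm)
  simp only [trapezoidSeq_index, Nat.cast_zero, sub_zero, add_zero] at htrap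
  have hhat : ∀ j ∈ Finset.range n,
      |(∫ x, trapezoid 0 (((q (L, k) : ℕ) + 1) * x - j + (M (L, k) : ℕ)) ∂(μ m : Measure ℝ)) -
        ∫ x, trapezoid 0 (((q (L, k) : ℕ) + 1) * x - j + (M (L, k) : ℕ)) ∂(ν : Measure ℝ)| ≤
        ε * (1 / 2) ^ n := by
    intro j hj
    have hCm : C ((L, k), j) ≤ m :=
      (Finset.single_le_sum (f := fun j => C ((L, k), j)) (fun _ _ => Nat.zero_le _) hj).trans
        ((Nat.le_add_left _ _).trans hm)
    have := hαμ _ _ m hCm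
    simp only [trapezoidSeq_index, Nat.cast_zero] at this
    rw [pow_add] at this
    exact this.le
  have hsum : ∑ j ∈ Finset.range n,
      |(∫ x, trapezoid 0 (((q (L, k) : ℕ) + 1) * x - j + (M (L, k) : ℕ)) ∂(μ m : Measure ℝ)) -
        ∫ x, trapezoid 0 (((q (L, k) : ℕ) + 1) * x - j + (M (L, k) : ℕ)) ∂(ν : Measure ℝ)| ≤
        ε := by
    refine (Finset.sum_le_sum hhat).trans ?_
    rw [Finset.sum_const, Finset.card_range, nsmul_eq_mul]
    have h1 := add_one_mul_half_pow_add_le n 0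
    rw [zero_add, pow_zero] at h1
    have h2 : (0 : ℝ) < (1 / 2) ^ n := by positivity
    nlinarith
  have hmesh : (L : ℝ) / ((q (L, k) : ℕ) + 1) ≤ ε := by
    have h1 : ε * 2 ^ (k + 3) = 1 := by rw [hε, ← mul_pow]; norm_num
    rw [div_le_iff₀ (by positivity)]
    simp only [q]
    push_cast
    nlinarith
  have hmain := norm_charFun_sub_charFun_le (μ m : Measure ℝ) (ν : Measure ℝ) (q (L, k))
    (M (L, k)) ht
  have hpow : (1 / 2 : ℝ) ^ k = 8 * ε := by rw [hε]; ring
  have htrap' := (abs_lt.1 htrap).1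
  -- Error budget: the limit's tail is below $\varepsilon$, that of $\mu_m$ below $2\varepsilon$,
  -- the mesh costs $2\varepsilon$ and the hats $\varepsilon$, in all less than $8\varepsilon$.
  rw [hpow]
  linarith
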